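/- Let $1\le k<n$ be integers. A network $G$ on the nodes $1,\dots,n$ is a hypergraph on these nodes; each hyperedge $e$ is a source that distributes an arbitrary quantum state $\gamma_e$ (of arbitrary finite local dimensions) to the nodes $v\in e$. $G$ is a $k$-network if every hyperedge has at most $k$ nodes. Node $v$ has a final system $\mathbb C^{d_v}$. Let $\mathcal S_{\rm C}(G)$ be the closure of the set of states on $\bigotimes_v\mathbb C^{d_v}$ that can be prepared from states of the form $\bigotimes_{e}\gamma_e$ by local operations and shared randomness, that is, of all states $$\sum_\lambda q_\lambda\Big(\bigotimes_v C_v^{(\lambda)}\Big)\Big(\bigotimes_e\gamma_e\Big),$$ where $(q_\lambda)$ is a finite probability distribution and $C_v^{(\lambda)}$ is a quantum channel from the systems received by node $v$ to $\mathbb C^{d_v}$. For a state $\rho$ on $\bigotimes_v\mathbb C^{d_v}$ define the network-entanglement weight $$\mathcal E_w(\rho)=\min\{p:\ \rho\succeq(1-p)\sigma\ \text{for some}\ \sigma\in\mathcal S_{\rm C}(G)\}.$$ Let each party $i$ perform on its part of $\rho$ a measurement $M_i$ with outcomes $\pm1$ (a two-outcome POVM), and let $\Gamma(\rho)$ be the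 $n\times n$ covariance matrix of the resulting outcomes $x_1,\dots,x_n$, i.e. $\Gamma_{ij}(\rho)=\langle x_ix_j\rangle-\langle x_i\rangle\langle x_j\rangle$. Put $$\omega(\rho)=\sum_{i,j=1}^n\Gamma_{ij}(\rho)-k\,\mathrm{tr}\,\Gamma(\rho),\qquad \beta(\rho)=2\sqrt{1-(\mathrm{tr}\,\rho^2)^2}.$$ Then, for every $k$-network $G$, every state $\rho$ and all $\pm1$-measurements $M_1,\dots,M_n$, $$\mathcal E_w(\rho)\ \ge\ \frac{\omega(\rho)}{n(n-k)}-\beta(\rho).$$ -/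

import Mathlib

noncomputable section

open scoped Matrix ComplexOrder

namespace QNet

/-- A density matrix: a positive semidefinite complex matrix of trace one. -/
def IsState {I : Type*} [Fintype I] (ρ : Matrix I I ℂ) : Prop :=
  ρ.PosSemidef ∧ ρ.trace = 1

/-- The tensor product of a family of (rectangular) matrices, one for each `v : V`.
The tensor product of the spaces `ℂ^(B v)` is identified with `ℂ^(∀ v, B v)`. -/
def tensor {V : Type*} [Fintype V] {A B : V → Type*}
    (K : ∀ v, Matrix (A v) (B v) ℂ) : Matrix (∀ v, A v) (∀ v, B v) ℂ :=
  Matrix.of fun x y => ∏ v, K v (x v) (y v)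

/-- A quantum channel (completely positive trace preserving map) from the matrices over `I` to the
matrices over `J`, presented by Kraus operators. -/
structure Channel (I J : Type*) [Fintype I] [DecidableEq I] [Fintype J] where
  /-- the number of Kraus operators -/
  num : ℕ
  /-- the Kraus operators -/
  kraus : Fin num → Matrix J I ℂ
  trace_preserving : ∑ a, (kraus a)ᴴ * kraus a = 1

/-- The action on `τ` of the product `⨂ v, C v` of local channels. -/
def applyLocal {V : Type*} [Fintype V] [DecidableEq V] {I J : V → Type*}
    [∀ v, Fintype (I v)] [∀ v, DecidableEq (I v)] [∀ v, Fintype (J v)]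
    (C : ∀ v, Channel (I v) (J v)) (τ : Matrix (∀ v, I v) (∀ v, I v) ℂ) :
    Matrix (∀ v, J v) (∀ v, J v) ℂ :=
  ∑ a : ∀ v, Fin (C v).num,
    tensor (fun v => (C v).kraus (a v)) * τ * (tensor (fun v => (C v).kraus (a v)))ᴴ

/-- A network with `n` nodes: a hypergraph on `Fin n`, given by its set of hyperedges.
Each hyperedge is a source that sends one system to each of its nodes. -/
abbrev Network (n : ℕ) := Finset (Finset (Fin n))

/-- A `k`-network: every source is at most `k`-partite. -/
def Network.IsKNetwork {n : ℕ} (G : Network n) (k : ℕ) : Prop :=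
  ∀ e ∈ G, e.card ≤ k

/-- Index set of a basis of the state space of the source `e`, that is of `⨂ v ∈ e, ℂ^(m e v)`,
where `m e v` is the dimension of the system sent by the source `e` to its node `v`. -/
abbrev SourceIdx {n : ℕ} (G : Network n) (m : {e // e ∈ G} → Fin n → ℕ) (e : {e // e ∈ G}) :=
  ∀ v : {v // v ∈ e.1}, Fin (m e v.1)

/-- Index set of a basis of the space of all systems received by the node `v`, that is of
the tensor product of the spaces `ℂ^(m e v)` over the sources `e` that contain `v`. -/
abbrev NodeIdx {n : ℕ} (G : Network n) (m : {e // e ∈ G} → Fin n → ℕ) (v : Fin n) :=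
  ∀ e : {e : {e // e ∈ G} // v ∈ e.1}, Fin (m e.1 v)

/-- The state `⨂ e, γ e` that the sources distribute in the network, with the
tensor factors grouped by nodes. -/
def networkState {n : ℕ} (G : Network n) (m : {e // e ∈ G} → Fin n → ℕ)
    (γ : ∀ e, Matrix (SourceIdx G m e) (SourceIdx G m e) ℂ) :
    Matrix (∀ v, NodeIdx G m v) (∀ v, NodeIdx G m v) ℂ :=
  Matrix.of fun x y => ∏ e : {e // e ∈ G},
    γ e (fun v => x v.1 ⟨e, v.2⟩) (fun v => y v.1 ⟨e, v.2⟩)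

/-- The matrices on `⨂ v, ℂ^(d v)`. -/
abbrev Op {n : ℕ} (d : Fin n → ℕ) := Matrix (∀ v, Fin (d v)) (∀ v, Fin (d v)) ℂ

/-- The states that can be prepared from `G` states by local operations and shared randomness:
the sources distribute states `γ e` of arbitrary finite local dimensions, and each node `v`
applies a local channel `C l v` chosen according to a shared random variable `l`, which takes the
value `l` with probability `q l`. -/
def losrStates {n : ℕ} (G : Network n) (d : Fin n → ℕ) : Set (Op d) :=
  {σ | ∃ (m : {e // e ∈ G} → Fin n → ℕ)
      (γ : ∀ e, Matrix (SourceIdx G m e) (SourceIdx G m e) ℂ)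
      (N : ℕ) (q : Fin N → ℝ)
      (C : Fin N → ∀ v, Channel (NodeIdx G m v) (Fin (d v))),
      (∀ e, IsState (γ e)) ∧ (∀ l, 0 ≤ q l) ∧ ∑ l, q l = 1 ∧
      σ = ∑ l, q l • applyLocal (C l) (networkState G m γ)}

/-- The set `S_C(G)`, the closure of the set of states preparable from `G` states by LOSR. -/
def freeStates {n : ℕ} (G : Network n) (d : Fin n → ℕ) : Set (Op d) :=
  closure (losrStates G d)

/-- The network-entanglement weight: the least `p` such that `ρ ⪰ (1 - p) σ` for some
`σ ∈ S_C(G)`. -/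
def weight {n : ℕ} (G : Network n) {d : Fin n → ℕ} (ρ : Op d) : ℝ :=
  sInf {p : ℝ | ∃ σ ∈ freeStates G d, (ρ - (1 - p) • σ).PosSemidef}

/-- A measurement on `ℂ^δ` with outcomes `1` and `-1` (the elements of `ℤˣ`):
a two-outcome POVM. Projective measurements are the case where the effects are projections. -/
structure PMMeasurement (δ : ℕ) where
  /-- the POVM element of each outcome -/
  effect : ℤˣ → Matrix (Fin δ) (Fin δ) ℂ
  posSemidef : ∀ s, (effect s).PosSemidef
  sum_eq_one : ∑ s, effect s = 1

/-- The probability of the joint outcome `x` when each party `v` performs the measurement `M v` on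
its part of `ρ`. -/
def outcomeProb {n : ℕ} {d : Fin n → ℕ} (M : ∀ v, PMMeasurement (d v)) (ρ : Op d)
    (x : Fin n → ℤˣ) : ℝ :=
  (tensor (fun v => (M v).effect (x v)) * ρ).trace.re

/-- The expectation of a function `f` of the joint outcome. -/
def expect {n : ℕ} {d : Fin n → ℕ} (M : ∀ v, PMMeasurement (d v)) (ρ : Op d)
    (f : (Fin n → ℤˣ) → ℝ) : ℝ :=
  ∑ x, outcomeProb M ρ x * f x

/-- The outcome of party `i` as a real random variable. -/
def outcome {n : ℕ} (i : Fin n) (x : Fin n → ℤˣ) : ℝ := ((x i : ℤ) : ℝ)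

/-- The covariance matrix `Γ(ρ)` of the outcomes of the measurements `M v` on `ρ`. -/
def covMatrix {n : ℕ} {d : Fin n → ℕ} (M : ∀ v, PMMeasurement (d v)) (ρ : Op d) :
    Matrix (Fin n) (Fin n) ℝ :=
  Matrix.of fun i j => expect M ρ (fun x => outcome i x * outcome j x)
    - expect M ρ (outcome i) * expect M ρ (outcome j)

/-- `ω(ρ) = ∑ i j, Γ i j (ρ) - k tr Γ(ρ)`. -/
def omega {n : ℕ} {d : Fin n → ℕ} (k : ℕ) (M : ∀ v, PMMeasurement (d v)) (ρ : Op d) : ℝ :=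
  (∑ i, ∑ j, covMatrix M ρ i j) - (k : ℝ) * (covMatrix M ρ).trace

/-- `β(ρ) = 2 √(1 - (tr ρ²)²)`. -/
def beta {n : ℕ} {d : Fin n → ℕ} (ρ : Op d) : ℝ :=
  2 * Real.sqrt (1 - ((ρ * ρ).trace.re) ^ 2)

end QNet

end

noncomputable section

open scoped Matrix ComplexOrder

namespace QNet

/-! Write ρ = (1-p)σ + pτ with σ free and τ a state. It suffices to show ω(ρ) ≤ n(n-k)(p + β(ρ)²):
if β < 1 then β² ≤ β, and if β ≥ 1 the claim is trivial because ω ≤ n(n-k) always (`omega_le`).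

By the law of total covariance, ω of a mixture is the mean of ω over the components plus a term
built from the deviations of their outcome means from those of ρ (`omega_mixture_le`). The component
τ contributes at most n(n-k)p. Components prepared without shared randomness contribute nothing
positive (`omega_network_nonpos`). For the deviations, Cauchy–Schwarz on square roots of
probabilities bounds each squared difference of means by 4(1 - (tr σ_l ρ)²), and Jensen turns the
average of the squared overlaps into (tr ρ²)². Limits of LOSR states follow by continuity
(`omega_add_le`).

The covariance criterion itself (`network_covariance`) is Hilbert-space geometry. Factor γ_e = L_e
L_e†, let S be the product of the L_e, and read A_i S as a vector a_i. The projection onto the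
vector of L_e fixes a_i unless source e reaches node i, so it changes at most k vectors and cannot
decrease ‖∑ a_i‖² - k ∑ ‖a_i‖² (`excess_le_of_projection`). Once all sources are projected, a_i has
become its mean value times one common unit vector. -/

open scoped MatrixOrder in
lemma exists_eq_conjTranspose_mul_self {X : Type*} [Fintype X] {P : Matrix X X ℂ}
    (hP : P.PosSemidef) : ∃ B : Matrix X X ℂ, P = Bᴴ * B := by
  classical
  exact CStarAlgebra.nonneg_iff_eq_star_mul_self.1 hP.nonneg

/-! ### Tensor products and operators acting on one factor -/

section Tensor

variable {V : Type*} [Fintype V] {A B C : V → Type*}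

lemma tensor_mul [DecidableEq V] [∀ v, Fintype (B v)] (K : ∀ v, Matrix (A v) (B v) ℂ)
    (L : ∀ v, Matrix (B v) (C v) ℂ) :
    tensor (fun v => K v * L v) = tensor K * tensor L := by
  ext x y
  simp [tensor, Matrix.mul_apply, Fintype.prod_sum, Finset.prod_mul_distrib]

lemma tensor_one [∀ v, DecidableEq (A v)] [DecidableEq (∀ v, A v)] :
    tensor (fun v => (1 : Matrix (A v) (A v) ℂ)) = 1 := by
  ext x y
  by_cases h : x = y
  · subst h; simp [tensor]
  · obtain ⟨v, hv⟩ := Function.ne_iff.1 h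
    simp only [tensor, Matrix.of_apply, Matrix.one_apply_ne h]
    exact Finset.prod_eq_zero (Finset.mem_univ v) (Matrix.one_apply_ne hv)

lemma tensor_conjTranspose (K : ∀ v, Matrix (A v) (B v) ℂ) :
    (tensor K)ᴴ = tensor fun v => (K v)ᴴ := by
  ext x y
  simp [tensor, Matrix.conjTranspose_apply]

lemma tensor_sum [DecidableEq V] {S : V → Type*} [∀ v, Fintype (S v)]
    (F : ∀ v, S v → Matrix (A v) (B v) ℂ) :
    tensor (fun v => ∑ s, F v s) = ∑ x : ∀ v, S v, tensor fun v => F v (x v) := by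
  ext a b
  simp [tensor, Matrix.sum_apply, Fintype.prod_sum]

lemma tensor_smul (c : V → ℂ) (K : ∀ v, Matrix (A v) (B v) ℂ) :
    tensor (fun v => c v • K v) = (∏ v, c v) • tensor K := by
  ext a b
  simp [tensor, Finset.prod_mul_distrib]

lemma tensor_posSemidef [DecidableEq V] [∀ v, Fintype (A v)]
    {K : ∀ v, Matrix (A v) (A v) ℂ} (hK : ∀ v, (K v).PosSemidef) : (tensor K).PosSemidef := by
  classical
  choose L hL using fun v => exists_eq_conjTranspose_mul_self (hK v)
  have : tensor K = (tensor L)ᴴ * tensor L := by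
    rw [tensor_conjTranspose, ← tensor_mul]
    exact congrArg tensor (funext hL)
  rw [this]
  exact Matrix.posSemidef_conjTranspose_mul_self _

/-- The operator `P` acting on the tensor factor `i`. -/
def embed [DecidableEq V] [∀ v, DecidableEq (A v)] (i : V) (P : Matrix (A i) (A i) ℂ) :
    Matrix (∀ v, A v) (∀ v, A v) ℂ :=
  tensor (Function.update (fun _ => 1) i P)

lemma embed_apply_update [DecidableEq V] [∀ v, DecidableEq (A v)] (i : V)
    (P : Matrix (A i) (A i) ℂ) (x : ∀ v, A v) (u : A i) :
    embed i P x (Function.update x i u) = P (x i) u := by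
  simp only [embed, tensor, Matrix.of_apply]
  rw [Finset.prod_eq_single i]
  · simp
  · intro v _ hv
    simp [Function.update_of_ne hv]
  · simp

lemma embed_apply_of_ne [DecidableEq V] [∀ v, DecidableEq (A v)] (i : V)
    (P : Matrix (A i) (A i) ℂ) {x y : ∀ v, A v} (h : y ∉ Set.range (Function.update x i)) :
    embed i P x y = 0 := by
  have : ∃ v, v ≠ i ∧ x v ≠ y v := by
    by_contra! hc
    refine h ⟨y i, ?_⟩
    ext v
    by_cases hv : v = i
    · subst hv; simp
    · rw [Function.update_of_ne hv, hc v hv]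
  obtain ⟨v, hv, hxy⟩ := this
  simp only [embed, tensor, Matrix.of_apply]
  refine Finset.prod_eq_zero (Finset.mem_univ v) ?_
  rw [Function.update_of_ne hv, Matrix.one_apply_ne hxy]

/-- A row of `embed i P` is supported on the indices that differ from `x` at most in coordinate `i`.
-/
lemma sum_embed_mul [DecidableEq V] [∀ v, DecidableEq (A v)] [∀ v, Fintype (A v)] (i : V)
    (P : Matrix (A i) (A i) ℂ) (x : ∀ v, A v) (f : (∀ v, A v) → ℂ) :
    ∑ y, embed i P x y * f y = ∑ u, P (x i) u * f (Function.update x i u) := by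
  classical
  rw [← Finset.sum_subset (Finset.subset_univ (Finset.univ.image (Function.update x i))),
    Finset.sum_image (fun a _ b _ h => Function.update_injective x i h)]
  · simp [embed_apply_update]
  · intro y _ hy
    rw [embed_apply_of_ne, zero_mul]
    simpa using hy

lemma embed_mul_embed_self [DecidableEq V] [∀ v, DecidableEq (A v)] [∀ v, Fintype (A v)] (i : V)
    (P Q : Matrix (A i) (A i) ℂ) : embed i P * embed i Q = embed i (P * Q) := by
  simp only [embed]
  rw [← tensor_mul]
  congr 1
  ext1 v
  by_cases hv : v = i
  · subst hv; simp
  · simp [Function.update_of_ne hv]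

lemma embed_conjTranspose [DecidableEq V] [∀ v, DecidableEq (A v)] (i : V)
    (P : Matrix (A i) (A i) ℂ) : (embed i P)ᴴ = embed i Pᴴ := by
  simp only [embed]
  rw [tensor_conjTranspose]
  congr 1
  ext1 v
  by_cases hv : v = i
  · subst hv; simp
  · simp [Function.update_of_ne hv]

lemma embed_one [DecidableEq V] [∀ v, DecidableEq (A v)] [DecidableEq (∀ v, A v)] (i : V) :
    embed i (1 : Matrix (A i) (A i) ℂ) = 1 := by
  rw [embed, ← tensor_one]
  congr 1
  exact Function.update_eq_self i _

lemma embed_posSemidef [DecidableEq V] [∀ v, DecidableEq (A v)] [∀ v, Fintype (A v)] (i : V)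
    {P : Matrix (A i) (A i) ℂ} (hP : P.PosSemidef) : (embed i P).PosSemidef := by
  refine tensor_posSemidef fun v => ?_
  by_cases hv : v = i
  · subst hv; simpa using hP
  · rw [Function.update_of_ne hv]; exact Matrix.PosSemidef.one

end Tensor

/-! ### Families of vectors under projections onto product vectors -/

section Projections

/-- The squared Euclidean norm. -/
def nsq {X : Type*} [Fintype X] (f : X → ℂ) : ℝ := ∑ x, ‖f x‖ ^ 2

lemma nsq_eq_dotProduct {X : Type*} [Fintype X] (f : X → ℂ) : nsq f = (star f ⬝ᵥ f).re := by
  simp only [nsq, dotProduct, Complex.re_sum, Pi.star_apply]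
  refine Finset.sum_congr rfl fun x _ => ?_
  rw [← Complex.normSq_eq_norm_sq, RCLike.star_def, ← Complex.normSq_eq_conj_mul_self,
    Complex.ofReal_re]

lemma nsq_smul {X : Type*} [Fintype X] (c : ℂ) (f : X → ℂ) : nsq (c • f) = ‖c‖ ^ 2 * nsq f := by
  simp [nsq, mul_pow, Finset.mul_sum]

lemma nsq_eq_add_of_projection {X : Type*} [Fintype X] {E : Matrix X X ℂ} (hE : E.IsHermitian)
    (hEE : E * E = E) (f : X → ℂ) : nsq f = nsq (E *ᵥ f) + nsq (f - E *ᵥ f) := by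
  have h1 : star (E *ᵥ f) ⬝ᵥ (E *ᵥ f) = star f ⬝ᵥ (E *ᵥ f) := by
    rw [Matrix.star_mulVec, hE.eq, ← Matrix.dotProduct_mulVec, Matrix.mulVec_mulVec, hEE]
  have h2 : star (E *ᵥ f) ⬝ᵥ f = star f ⬝ᵥ (E *ᵥ f) := by
    rw [Matrix.star_mulVec, hE.eq, ← Matrix.dotProduct_mulVec]
  simp only [nsq_eq_dotProduct, star_sub, sub_dotProduct, dotProduct_sub, h1, h2, Complex.sub_re]
  ring

lemma nsq_sum_le {X ι : Type*} [Fintype X] (s : Finset ι) (b : ι → X → ℂ) :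
    nsq (∑ i ∈ s, b i) ≤ s.card * ∑ i ∈ s, nsq (b i) := by
  simp only [nsq]
  rw [Finset.sum_comm, Finset.mul_sum]
  refine Finset.sum_le_sum fun x _ => ?_
  rw [Finset.sum_apply]
  calc ‖∑ i ∈ s, b i x‖ ^ 2 ≤ (∑ i ∈ s, ‖b i x‖) ^ 2 := by
        gcongr; exact norm_sum_le _ _
    _ ≤ _ := sq_sum_le_card_mul_sum_sq

/-- `‖∑ i, a i‖² - k ∑ i, ‖a i‖²`. -/
def excess {X : Type*} [Fintype X] {n : ℕ} (k : ℕ) (a : Fin n → X → ℂ) : ℝ :=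
  nsq (∑ i, a i) - k * ∑ i, nsq (a i)

/-- Norms split orthogonally along `E`. The complementary parts vanish off `s`, so their sum has at
most `k` terms and Cauchy–Schwarz makes their own excess nonpositive. -/
lemma excess_le_of_projection {X : Type*} [Fintype X] {n k : ℕ} {E : Matrix X X ℂ}
    (hE : E.IsHermitian) (hEE : E * E = E) (s : Finset (Fin n)) (hs : s.card ≤ k)
    (a : Fin n → X → ℂ) (ha : ∀ i ∉ s, E *ᵥ a i = a i) :
    excess k a ≤ excess k fun i => E *ᵥ a i := by
  have h1 := nsq_eq_add_of_projection hE hEE (∑ i, a i)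
  have h2 : ∑ i, nsq (a i) = ∑ i, nsq (E *ᵥ a i) + ∑ i, nsq (a i - E *ᵥ a i) := by
    rw [← Finset.sum_add_distrib]
    exact Finset.sum_congr rfl fun i _ => nsq_eq_add_of_projection hE hEE (a i)
  have h3 : E *ᵥ (∑ i, a i) = ∑ i, E *ᵥ a i := by
    rw [Matrix.mulVec_sum]
  have h4 : nsq (∑ i, a i - ∑ i, E *ᵥ a i) ≤ k * ∑ i, nsq (a i - E *ᵥ a i) := by
    have e1 : ∑ i, a i - ∑ i, E *ᵥ a i = ∑ i ∈ s, (a i - E *ᵥ a i) := by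
      rw [← Finset.sum_sub_distrib]
      refine (Finset.sum_subset (Finset.subset_univ s) fun i _ hi => ?_).symm
      rw [ha i hi, sub_self]
    rw [e1]
    have hnn : ∀ i, 0 ≤ nsq (a i - E *ᵥ a i) := fun i => Finset.sum_nonneg fun _ _ => by positivity
    exact (nsq_sum_le s _).trans (mul_le_mul (Nat.cast_le.2 hs)
      (Finset.sum_le_sum_of_subset_of_nonneg (Finset.subset_univ s) fun i _ _ => hnn i)
      (Finset.sum_nonneg fun i _ => hnn i) (Nat.cast_nonneg k))
  simp only [excess]
  rw [h1, h2, h3]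
  linarith

variable {ι : Type*} [Fintype ι] [DecidableEq ι] {W : ι → Type*} [∀ e, Fintype (W e)]
  [∀ e, DecidableEq (W e)]

/-- Project one factor at a time; the product of all the rank-one projections is the projection onto
the product vector. -/
lemma excess_le_of_product (ψ : ∀ e, W e → ℂ) (hψ : ∀ e, star (ψ e) ⬝ᵥ ψ e = 1) {n k : ℕ}
    (inc : ι → Finset (Fin n)) (hinc : ∀ e, (inc e).card ≤ k) (a : Fin n → (∀ e, W e) → ℂ)
    (ha : ∀ e, ∀ i ∉ inc e,
      embed e (Matrix.vecMulVec (ψ e) (star (ψ e))) *ᵥ a i = a i) :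
    excess k a ≤ excess k fun i =>
      (star (fun w : ∀ e, W e => ∏ e, ψ e (w e)) ⬝ᵥ a i) • fun w : ∀ e, W e => ∏ e, ψ e (w e) := by
  set R : ∀ e, Matrix (W e) (W e) ℂ := fun e => Matrix.vecMulVec (ψ e) (star (ψ e)) with hR
  have hRR : ∀ e, R e * R e = R e := fun e => by
    rw [hR]
    simp only [Matrix.vecMulVec_mul_vecMulVec, hψ, one_smul]
  have hRH : ∀ e, (R e)ᴴ = R e := fun e => by
    simp [hR, Matrix.conjTranspose_vecMulVec]
  set P : Finset ι → Matrix (∀ e, W e) (∀ e, W e) ℂ :=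
    fun s => tensor fun e => if e ∈ s then R e else 1 with hP
  have hins : ∀ e s, e ∉ s → P (insert e s) = embed e (R e) * P s := fun e s hes => by
    simp only [hP, embed]
    rw [← tensor_mul]
    congr 1
    ext1 v
    by_cases hv : v = e
    · subst hv; simp [hes]
    · simp [hv]
  have hcomm : ∀ e s, e ∉ s → embed e (R e) * P s = P s * embed e (R e) := fun e s hes => by
    simp only [hP, embed]
    rw [← tensor_mul, ← tensor_mul]
    congr 1
    ext1 v
    by_cases hv : v = e
    · subst hv; simp [hes]
    · simp [Function.update_of_ne hv]
  have key : ∀ s, excess k a ≤ excess k fun i => P s *ᵥ a i := by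
    intro s
    induction s using Finset.induction_on with
    | empty =>
      have : P ∅ = 1 := by simp [hP, tensor_one]
      simp [this]
    | insert e s hes ih =>
      refine ih.trans ?_
      -- The vectors already projected are still fixed by the new projection when `i ∉ inc e`, since
      -- projections on different factors commute.
      have := excess_le_of_projection (E := embed e (R e))
        (by rw [Matrix.IsHermitian, embed_conjTranspose, hRH])
        (by rw [embed_mul_embed_self, hRR]) (inc e) (hinc e) (fun i => P s *ᵥ a i)
        (fun i hi => by
          rw [Matrix.mulVec_mulVec, hcomm e s hes, ← Matrix.mulVec_mulVec, ha e i hi])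
      simpa only [Matrix.mulVec_mulVec, ← hins e s hes] using this
  refine (key Finset.univ).trans_eq ?_
  congr 1
  ext i w
  simp only [hP, hR, Matrix.mulVec, dotProduct, Finset.mem_univ, if_true, tensor, Matrix.of_apply,
    Matrix.vecMulVec_apply, Pi.star_apply, Pi.smul_apply, smul_eq_mul, Finset.prod_mul_distrib,
    star_prod]
  rw [Finset.sum_mul]
  exact Finset.sum_congr rfl fun _ _ => by ring

lemma embed_mulVec_eq_self (ψ : ∀ e, W e → ℂ) (e : ι) (hψ : star (ψ e) ⬝ᵥ ψ e = 1)
    (g : (∀ e, W e) → ℂ) (hg : ∀ w u, g (Function.update w e u) = g w) :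
    embed e (Matrix.vecMulVec (ψ e) (star (ψ e))) *ᵥ (fun w => ψ e (w e) * g w) =
      fun w => ψ e (w e) * g w := by
  ext w
  simp only [Matrix.mulVec]
  rw [dotProduct, sum_embed_mul]
  simp only [Matrix.vecMulVec_apply, Function.update_self, hg]
  rw [dotProduct] at hψ
  calc ∑ u, ψ e (w e) * star (ψ e) u * (ψ e u * g w)
      = (∑ u, star (ψ e) u * ψ e u) * (ψ e (w e) * g w) := by
        rw [Finset.sum_mul]; exact Finset.sum_congr rfl fun _ _ => by ring
    _ = _ := by rw [hψ, one_mul]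

end Projections

/-! ### Trace inequalities and Bhattacharyya coefficients -/

section Traces

variable {X : Type*} [Fintype X]

lemma trace_mul_re_nonneg {P Q : Matrix X X ℂ} (hP : P.PosSemidef) (hQ : Q.PosSemidef) :
    0 ≤ (P * Q).trace.re := by
  obtain ⟨B, rfl⟩ := exists_eq_conjTranspose_mul_self hP
  rw [Matrix.mul_assoc, Matrix.trace_mul_comm]
  exact (Complex.nonneg_iff.1 (hQ.mul_mul_conjTranspose_same B).trace_nonneg).1

lemma one_sub_posSemidef [DecidableEq X] {σ : Matrix X X ℂ} (hσ : IsState σ) :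
    (1 - σ).PosSemidef := by
  obtain ⟨hp, ht⟩ := hσ
  have hle : ∀ i, hp.1.eigenvalues i ≤ 1 := fun i => by
    have h1 := hp.1.trace_eq_sum_eigenvalues
    rw [ht] at h1
    have h2 : ∑ j, hp.1.eigenvalues j = 1 := by
      apply Complex.ofReal_injective
      rw [Complex.ofReal_sum]
      simpa using h1.symm
    rw [← h2]
    exact Finset.single_le_sum (fun j _ => hp.eigenvalues_nonneg j) (Finset.mem_univ i)
  set U : Matrix X X ℂ := hp.1.eigenvectorUnitary.1 with hU
  have hUU : U * Uᴴ = 1 := Unitary.coe_mul_star_self hp.1.eigenvectorUnitary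
  have hs : σ = U * Matrix.diagonal (fun i => (hp.1.eigenvalues i : ℂ)) * Uᴴ := by
    have := hp.1.spectral_theorem
    rw [Unitary.conjStarAlgAut_apply] at this
    exact this
  have : 1 - σ = U * Matrix.diagonal (fun i => 1 - (hp.1.eigenvalues i : ℂ)) * Uᴴ := by
    rw [← Matrix.diagonal_sub, Matrix.diagonal_one, Matrix.mul_sub, Matrix.sub_mul, Matrix.mul_one,
      hUU, ← hs]
  rw [this]
  refine (Matrix.PosSemidef.diagonal fun i => ?_).mul_mul_conjTranspose_same U
  simp only [Pi.zero_apply, sub_nonneg]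
  exact_mod_cast hle i

/-- F - F² = F(1-F)F + (1-F)F(1-F), which avoids a square root or diagonalisation of F. -/
lemma sub_sq_posSemidef [DecidableEq X] {F : Matrix X X ℂ} (hF : F.PosSemidef)
    (hF' : (1 - F).PosSemidef) : (F - F * F).PosSemidef := by
  have h : F - F * F = Fᴴ * (1 - F) * F + (1 - F)ᴴ * F * (1 - F) := by
    rw [hF.1.eq, hF'.1.eq]
    noncomm_ring
  rw [h]
  exact (hF'.conjTranspose_mul_mul_same F).add (hF.conjTranspose_mul_mul_same (1 - F))

lemma trace_conjTranspose_mul_self_re (B : Matrix X X ℂ) :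
    (Bᴴ * B).trace.re = ∑ p : X × X, ‖B p.1 p.2‖ ^ 2 := by
  rw [Fintype.sum_prod_type, Finset.sum_comm]
  simp only [Matrix.trace, Matrix.diag, Matrix.mul_apply, Matrix.conjTranspose_apply,
    Complex.re_sum]
  refine Finset.sum_congr rfl fun x _ => Finset.sum_congr rfl fun y _ => ?_
  rw [RCLike.star_def, ← Complex.normSq_eq_conj_mul_self, Complex.ofReal_re,
    Complex.normSq_eq_norm_sq]

lemma trace_conjTranspose_mul_re_le (B C : Matrix X X ℂ) :
    (Bᴴ * C).trace.re ≤ √((Bᴴ * B).trace.re) * √((Cᴴ * C).trace.re) := by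
  rw [trace_conjTranspose_mul_self_re, trace_conjTranspose_mul_self_re]
  refine le_trans ?_ (Real.sum_mul_le_sqrt_mul_sqrt Finset.univ _ _)
  rw [Fintype.sum_prod_type, Finset.sum_comm]
  simp only [Matrix.trace, Matrix.diag, Matrix.mul_apply, Matrix.conjTranspose_apply,
    Complex.re_sum]
  refine Finset.sum_le_sum fun x _ => Finset.sum_le_sum fun y _ => ?_
  refine (Complex.re_le_norm _).trans ?_
  rw [norm_mul, norm_star]

/-- An effect of a measurement contributes to the overlap of two states at most the geometric mean
of its probabilities in these states. -/
lemma trace_mul_mul_re_le {σ τ P : Matrix X X ℂ} (hσ : IsState σ) (hτ : IsState τ)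
    (hP : P.PosSemidef) :
    (σ * P * τ).trace.re ≤ √((P * σ).trace.re) * √((P * τ).trace.re) := by
  classical
  -- υ² ≤ υ for a state. With P = B†B, this bounds the two squared Hilbert–Schmidt norms that
  -- Cauchy–Schwarz for Bσ and Bτ produces.
  have aux : ∀ {υ : Matrix X X ℂ}, IsState υ → (υ * P * υ).trace.re ≤ (P * υ).trace.re := by
    intro υ hυ
    have := trace_mul_re_nonneg hP (sub_sq_posSemidef hυ.1 (one_sub_posSemidef hυ))
    rw [Matrix.mul_sub, Matrix.trace_sub, Complex.sub_re, sub_nonneg] at this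
    rwa [Matrix.mul_assoc, Matrix.trace_mul_comm, Matrix.mul_assoc]
  have h1 := aux hσ
  have h2 := aux hτ
  obtain ⟨B, hB⟩ := exists_eq_conjTranspose_mul_self hP
  have e : ∀ {υ υ' : Matrix X X ℂ}, IsState υ → (B * υ)ᴴ * (B * υ') = υ * P * υ' := by
    intro υ υ' hυ
    rw [Matrix.conjTranspose_mul, hυ.1.1.eq, hB]
    simp only [Matrix.mul_assoc]
  have h3 := trace_conjTranspose_mul_re_le (B * σ) (B * τ)
  rw [e hσ, e hσ, e hτ] at h3
  exact h3.trans (mul_le_mul (Real.sqrt_le_sqrt h1) (Real.sqrt_le_sqrt h2) (Real.sqrt_nonneg _)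
    (Real.sqrt_nonneg _))

/-- The trace distance of two finite probability distributions is controlled by their
Bhattacharyya coefficient. -/
lemma sq_sum_sub_mul_le {Y : Type*} [Fintype Y] {p q f : Y → ℝ} (hp : ∀ y, 0 ≤ p y)
    (hq : ∀ y, 0 ≤ q y) (hp1 : ∑ y, p y = 1) (hq1 : ∑ y, q y = 1) (hf : ∀ y, |f y| ≤ 1) :
    (∑ y, (p y - q y) * f y) ^ 2 ≤ 4 * (1 - (∑ y, √(p y) * √(q y)) ^ 2) := by
  -- Factor p - q = (√p - √q)(√p + √q). With b the Bhattacharyya coefficient, Cauchy–Schwarz gives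
  -- (2 - 2b)(2 + 2b).
  have h1 : (∑ y, (p y - q y) * f y) ^ 2 =
      (∑ y, ((√(p y) - √(q y)) * f y) * (√(p y) + √(q y))) ^ 2 := by
    congr 1
    refine Finset.sum_congr rfl fun y _ => ?_
    linear_combination (-f y) * Real.sq_sqrt (hp y) + f y * Real.sq_sqrt (hq y)
  have hs : ∀ y, (√(p y) - √(q y)) ^ 2 = p y + q y - 2 * (√(p y) * √(q y)) := fun y => by
    linear_combination Real.sq_sqrt (hp y) + Real.sq_sqrt (hq y)
  have ha : ∀ y, (√(p y) + √(q y)) ^ 2 = p y + q y + 2 * (√(p y) * √(q y)) := fun y => by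
    linear_combination Real.sq_sqrt (hp y) + Real.sq_sqrt (hq y)
  have h2 : ∑ y, ((√(p y) - √(q y)) * f y) ^ 2 ≤ 2 - 2 * ∑ y, √(p y) * √(q y) := by
    calc _ ≤ ∑ y, (p y + q y - 2 * (√(p y) * √(q y))) := by
          refine Finset.sum_le_sum fun y _ => ?_
          rw [mul_pow, ← hs]
          exact mul_le_of_le_one_right (sq_nonneg _) ((sq_le_one_iff_abs_le_one _).2 (hf y))
      _ = _ := by
          rw [Finset.sum_sub_distrib, Finset.sum_add_distrib, hp1, hq1, Finset.mul_sum]; norm_num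
  have h3 : ∑ y, (√(p y) + √(q y)) ^ 2 = 2 + 2 * ∑ y, √(p y) * √(q y) := by
    simp only [ha]
    rw [Finset.sum_add_distrib, Finset.sum_add_distrib, hp1, hq1, Finset.mul_sum]; norm_num
  rw [h1]
  refine (Finset.sum_mul_sq_le_sq_mul_sq _ _ _).trans ?_
  rw [h3]
  have : 0 ≤ ∑ y, √(p y) * √(q y) := Finset.sum_nonneg fun y _ => by positivity
  nlinarith

end Traces

/-! ### Outcome statistics and the functional ω -/

section Measurements

variable {n : ℕ} {d : Fin n → ℕ} (M : ∀ v, PMMeasurement (d v))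

lemma sum_tensor_effect : ∑ x : Fin n → ℤˣ, tensor (fun v => (M v).effect (x v)) = 1 := by
  rw [← tensor_sum fun v s => (M v).effect s]
  simp only [PMMeasurement.sum_eq_one]
  exact tensor_one

lemma tensor_effect_posSemidef (x : Fin n → ℤˣ) :
    (tensor fun v => (M v).effect (x v)).PosSemidef :=
  tensor_posSemidef fun v => (M v).posSemidef (x v)

lemma outcomeProb_nonneg {ρ : Op d} (hρ : ρ.PosSemidef) (x : Fin n → ℤˣ) :
    0 ≤ outcomeProb M ρ x :=
  trace_mul_re_nonneg (tensor_effect_posSemidef M x) hρ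

lemma sum_outcomeProb (ρ : Op d) : ∑ x, outcomeProb M ρ x = ρ.trace.re := by
  simp only [outcomeProb]
  rw [← Complex.re_sum, ← Matrix.trace_sum, ← Finset.sum_mul, sum_tensor_effect, Matrix.one_mul]

/-- Insert the product POVM as a resolution of the identity between σ and τ. -/
lemma overlap_le_sum_sqrt {σ τ : Op d} (hσ : IsState σ) (hτ : IsState τ) :
    (σ * τ).trace.re ≤ ∑ x, √(outcomeProb M σ x) * √(outcomeProb M τ x) := by
  have : σ * τ = ∑ x : Fin n → ℤˣ, σ * tensor (fun v => (M v).effect (x v)) * τ := by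
    rw [← Finset.sum_mul, ← Finset.mul_sum, sum_tensor_effect, Matrix.mul_one]
  rw [this, Matrix.trace_sum, Complex.re_sum]
  exact Finset.sum_le_sum fun x _ => trace_mul_mul_re_le hσ hτ (tensor_effect_posSemidef M x)

lemma sq_expect_sub_le {σ τ : Op d} (hσ : IsState σ) (hτ : IsState τ) {f : (Fin n → ℤˣ) → ℝ}
    (hf : ∀ x, |f x| ≤ 1) :
    (expect M σ f - expect M τ f) ^ 2 ≤ 4 * (1 - (σ * τ).trace.re ^ 2) := by
  have h := sq_sum_sub_mul_le (outcomeProb_nonneg M hσ.1) (outcomeProb_nonneg M hτ.1)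
    (by rw [sum_outcomeProb, hσ.2, Complex.one_re]) (by rw [sum_outcomeProb, hτ.2, Complex.one_re])
    hf
  simp only [sub_mul, Finset.sum_sub_distrib] at h
  refine h.trans ?_
  have h0 := trace_mul_re_nonneg hσ.1 hτ.1
  have h1 := overlap_le_sum_sqrt M hσ hτ
  gcongr

lemma expect_add (ρ : Op d) (f g : (Fin n → ℤˣ) → ℝ) :
    expect M ρ (fun x => f x + g x) = expect M ρ f + expect M ρ g := by
  simp [expect, mul_add, Finset.sum_add_distrib]

lemma expect_sum {ι : Type*} (s : Finset ι) (ρ : Op d) (f : ι → (Fin n → ℤˣ) → ℝ) :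
    expect M ρ (fun x => ∑ i ∈ s, f i x) = ∑ i ∈ s, expect M ρ (f i) := by
  simp only [expect, Finset.mul_sum]
  exact Finset.sum_comm

lemma expect_const_mul (ρ : Op d) (c : ℝ) (f : (Fin n → ℤˣ) → ℝ) :
    expect M ρ (fun x => c * f x) = c * expect M ρ f := by
  simp only [expect, Finset.mul_sum]
  exact Finset.sum_congr rfl fun _ _ => by ring

lemma expect_one {ρ : Op d} (hρ : IsState ρ) : expect M ρ (fun _ => 1) = 1 := by
  simp [expect, sum_outcomeProb, hρ.2]

lemma expect_mono {ρ : Op d} (hρ : ρ.PosSemidef) {f g : (Fin n → ℤˣ) → ℝ} (h : ∀ x, f x ≤ g x) :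
    expect M ρ f ≤ expect M ρ g :=
  Finset.sum_le_sum fun x _ => mul_le_mul_of_nonneg_left (h x) (outcomeProb_nonneg M hρ x)

lemma outcomeProb_mixture {ι : Type*} (s : Finset ι) (w : ι → ℝ) (σ : ι → Op d)
    (x : Fin n → ℤˣ) :
    outcomeProb M (∑ l ∈ s, w l • σ l) x = ∑ l ∈ s, w l * outcomeProb M (σ l) x := by
  simp only [outcomeProb, Finset.mul_sum, Matrix.trace_sum, Complex.re_sum, Matrix.mul_smul,
    Matrix.trace_smul, Complex.smul_re, smul_eq_mul]

lemma expect_mixture {ι : Type*} (s : Finset ι) (w : ι → ℝ) (σ : ι → Op d)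
    (f : (Fin n → ℤˣ) → ℝ) :
    expect M (∑ l ∈ s, w l • σ l) f = ∑ l ∈ s, w l * expect M (σ l) f := by
  simp only [expect, outcomeProb_mixture, Finset.sum_mul, Finset.mul_sum]
  rw [Finset.sum_comm]
  exact Finset.sum_congr rfl fun _ _ => Finset.sum_congr rfl fun _ _ => by ring

lemma outcome_sq (i : Fin n) (x : Fin n → ℤˣ) : outcome i x * outcome i x = 1 := by
  simp only [outcome]
  rcases Int.units_eq_one_or (x i) with h | h <;> simp [h]

lemma abs_outcome (i : Fin n) (x : Fin n → ℤˣ) : |outcome i x| ≤ 1 := by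
  rw [← sq_le_one_iff_abs_le_one, sq, outcome_sq]

lemma covMatrix_self {ρ : Op d} (hρ : IsState ρ) (i : Fin n) :
    covMatrix M ρ i i = 1 - expect M ρ (outcome i) ^ 2 := by
  simp only [covMatrix, Matrix.of_apply, outcome_sq, expect_one M hρ, sq]

lemma sum_covMatrix (ρ : Op d) : ∑ i, ∑ j, covMatrix M ρ i j =
    expect M ρ (fun x => (∑ i, outcome i x) ^ 2) - (∑ i, expect M ρ (outcome i)) ^ 2 := by
  simp only [covMatrix, Matrix.of_apply, Finset.sum_sub_distrib]
  congr 1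
  · rw [← Finset.sum_congr rfl fun i _ => expect_sum M Finset.univ ρ _, ← expect_sum]
    simp only [sq, Finset.sum_mul_sum]
  · simp only [sq, Finset.sum_mul_sum]

lemma omega_eq {ρ : Op d} (hρ : IsState ρ) (k : ℕ) : omega k M ρ =
    expect M ρ (fun x => (∑ i, outcome i x) ^ 2) - k * n - (∑ i, expect M ρ (outcome i)) ^ 2
      + k * ∑ i, expect M ρ (outcome i) ^ 2 := by
  have : (covMatrix M ρ).trace = n - ∑ i, expect M ρ (outcome i) ^ 2 := by
    simp only [Matrix.trace, Matrix.diag, covMatrix_self M hρ, Finset.sum_sub_distrib]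
    simp
  rw [omega, sum_covMatrix, this]
  ring

/-- Cauchy–Schwarz over the parties gives ∑ Γ_ij ≤ n tr Γ, and tr Γ ≤ n because outcomes are ±1. -/
lemma omega_le {ρ : Op d} (hρ : IsState ρ) {k : ℕ} (hkn : k ≤ n) :
    omega k M ρ ≤ n * (n - k) := by
  set m : Fin n → ℝ := fun i => expect M ρ (outcome i) with hm
  have h1 : expect M ρ (fun x => (∑ i, (outcome i x - m i)) ^ 2) ≤
      expect M ρ (fun x => n * ∑ i, (outcome i x - m i) ^ 2) := by
    refine expect_mono M hρ.1 fun x => ?_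
    have := sq_sum_le_card_mul_sum_sq (s := Finset.univ) (f := fun i => outcome i x - m i)
    simpa using this
  have h2 : expect M ρ (fun x => (∑ i, (outcome i x - m i)) ^ 2) =
      expect M ρ (fun x => (∑ i, outcome i x) ^ 2) - (∑ i, m i) ^ 2 := by
    have e : ∀ x, (∑ i, (outcome i x - m i)) ^ 2 =
        (∑ i, outcome i x) ^ 2 + ((∑ i, (-2 * ∑ i, m i) * outcome i x) + (∑ i, m i) ^ 2 * 1) := by
      intro x
      rw [← Finset.mul_sum, Finset.sum_sub_distrib]; ring
    simp only [e, expect_add, expect_sum]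
    simp only [expect_const_mul, expect_one M hρ]
    rw [← Finset.mul_sum]
    simp only [hm]
    ring
  have h3 : expect M ρ (fun x => n * ∑ i, (outcome i x - m i) ^ 2) =
      n * (n - ∑ i, m i ^ 2) := by
    have e : ∀ x, n * ∑ i, (outcome i x - m i) ^ 2 =
        n * (n + ∑ i, m i ^ 2) * 1 + ∑ i, (-2 * n * m i) * outcome i x := by
      intro x
      have : ∀ i, (outcome i x - m i) ^ 2 = 1 + m i ^ 2 - 2 * m i * outcome i x := fun i => by
        linear_combination outcome_sq i x
      simp only [this, Finset.sum_sub_distrib, Finset.sum_add_distrib, Finset.mul_sum, mul_sub,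
        mul_add]
      simp only [Finset.sum_const, Finset.card_univ, Fintype.card_fin, nsmul_eq_mul]
      rw [sub_eq_add_neg, ← Finset.sum_neg_distrib]
      congr 1
      · ring
      · exact Finset.sum_congr rfl fun _ _ => by ring
    simp only [e, expect_add, expect_sum, expect_const_mul, expect_one M hρ]
    have : ∀ i, -2 * (n : ℝ) * m i * expect M ρ (outcome i) = -2 * n * m i ^ 2 := fun i => by
      simp only [hm]; ring
    simp only [this]
    rw [← Finset.mul_sum]
    ring
  rw [omega_eq M hρ]
  rw [h2, h3] at h1
  have h4 : 0 ≤ ∑ i, m i ^ 2 := Finset.sum_nonneg fun i _ => sq_nonneg _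
  have h5 : (k : ℝ) ≤ n := Nat.cast_le.2 hkn
  nlinarith

/-- The value of `ω` on a mixture exceeds the mean value of `ω` by at most a multiple of the mean
of `1 - (tr ρ σ)²`. -/
lemma omega_mixture_le {ι : Type*} [Fintype ι] {w : ι → ℝ} {σ : ι → Op d} (hw : ∀ l, 0 ≤ w l)
    (hw1 : ∑ l, w l = 1) (hσ : ∀ l, IsState (σ l)) (hρ : IsState (∑ l, w l • σ l)) {k : ℕ}
    (hkn : k ≤ n) :
    omega k M (∑ l, w l • σ l) ≤ ∑ l, w l * omega k M (σ l)
      + n * (n - k) * (4 * (1 - ((∑ l, w l • σ l) * (∑ l, w l • σ l)).trace.re ^ 2)) := by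
  set ρ := ∑ l, w l • σ l with hρdef
  set m : Fin n → ℝ := fun i => expect M ρ (outcome i) with hm
  set μ : ι → Fin n → ℝ := fun l i => expect M (σ l) (outcome i) with hμ
  have hmμ : ∀ i, m i = ∑ l, w l * μ l i := fun i => expect_mixture M _ w σ _
  have h5 : (k : ℝ) ≤ n := Nat.cast_le.2 hkn
  -- Law of total covariance: the second sum is the same functional applied to the covariance of the
  -- conditional means.
  have hvar : omega k M ρ = ∑ l, w l * omega k M (σ l)
      + ∑ l, w l * ((∑ i, (μ l i - m i)) ^ 2 - k * ∑ i, (μ l i - m i) ^ 2) := by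
    rw [omega_eq M hρ, ← Finset.sum_add_distrib]
    have e : ∀ l, w l * omega k M (σ l)
        + w l * ((∑ i, (μ l i - m i)) ^ 2 - k * ∑ i, (μ l i - m i) ^ 2)
        = w l * expect M (σ l) (fun x => (∑ i, outcome i x) ^ 2)
          + w l * (-(k * n) + (∑ i, m i) ^ 2 - k * ∑ i, m i ^ 2)
          - 2 * (∑ i, m i) * (∑ i, w l * μ l i) + 2 * k * ∑ i, m i * (w l * μ l i) := by
      intro l
      rw [omega_eq M (hσ l)]
      have e1 : ∑ i, (μ l i - m i) ^ 2 =
          ∑ i, μ l i ^ 2 + ∑ i, m i ^ 2 - 2 * ∑ i, m i * μ l i := by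
        rw [Finset.mul_sum, ← Finset.sum_add_distrib, ← Finset.sum_sub_distrib]
        exact Finset.sum_congr rfl fun _ _ => by ring
      have e2 : ∑ i, m i * (w l * μ l i) = w l * ∑ i, m i * μ l i := by
        rw [Finset.mul_sum]
        exact Finset.sum_congr rfl fun _ _ => by ring
      rw [e1, e2, Finset.sum_sub_distrib, ← Finset.mul_sum]
      simp only [hμ]
      ring
    simp only [e]
    rw [Finset.sum_add_distrib, Finset.sum_sub_distrib, Finset.sum_add_distrib, ← Finset.sum_mul,
      hw1, ← Finset.mul_sum, ← Finset.mul_sum, Finset.sum_comm, hρdef, expect_mixture]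
    have e3 : ∑ l, ∑ i, m i * (w l * μ l i) = ∑ i, m i ^ 2 := by
      rw [Finset.sum_comm]
      refine Finset.sum_congr rfl fun i _ => ?_
      rw [← Finset.mul_sum, ← hmμ, sq]
    rw [e3, ← Finset.sum_congr rfl fun i _ => hmμ i, ← hρdef]
    simp only [← hm]
    have e4 : ∑ i, expect M ρ (outcome i) ^ 2 = ∑ i, m i ^ 2 := rfl
    have e5 : ∑ i, expect M ρ (outcome i) = ∑ i, m i := rfl
    rw [e4, e5]
    ring
  have hbound : ∀ l, (∑ i, (μ l i - m i)) ^ 2 - k * ∑ i, (μ l i - m i) ^ 2 ≤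
      n * (n - k) * (4 * (1 - (σ l * ρ).trace.re ^ 2)) := by
    intro l
    -- Cauchy–Schwarz leaves the factor n - k ≥ 0, and the sum over the n parties supplies the other
    -- factor n.
    have a1 : (∑ i, (μ l i - m i)) ^ 2 ≤ n * ∑ i, (μ l i - m i) ^ 2 := by
      simpa using sq_sum_le_card_mul_sum_sq (s := Finset.univ) (f := fun i => μ l i - m i)
    have a2 : ∑ i, (μ l i - m i) ^ 2 ≤ n * (4 * (1 - (σ l * ρ).trace.re ^ 2)) := by
      calc _ ≤ ∑ _i : Fin n, 4 * (1 - (σ l * ρ).trace.re ^ 2) :=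
            Finset.sum_le_sum fun i _ => sq_expect_sub_le M (hσ l) hρ (abs_outcome i)
        _ = _ := by simp
    have a3 := mul_le_mul_of_nonneg_left a2 (sub_nonneg.2 h5)
    nlinarith
  have hover : (ρ * ρ).trace.re = ∑ l, w l * (σ l * ρ).trace.re := by
    nth_rewrite 1 [hρdef]
    simp only [Finset.sum_mul, Matrix.trace_sum, Complex.re_sum, Matrix.smul_mul,
      Matrix.trace_smul, Complex.smul_re, smul_eq_mul]
  have hjensen : (ρ * ρ).trace.re ^ 2 ≤ ∑ l, w l * (σ l * ρ).trace.re ^ 2 := by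
    rw [hover]
    exact Real.pow_arith_mean_le_arith_mean_pow_of_even _ _ _ (fun l _ => hw l) hw1 even_two
  rw [hvar]
  refine add_le_add_right ?_ _
  calc _ ≤ ∑ l, w l * (n * (n - k) * (4 * (1 - (σ l * ρ).trace.re ^ 2))) :=
        Finset.sum_le_sum fun l _ => mul_le_mul_of_nonneg_left (hbound l) (hw l)
    _ = n * (n - k) * (4 * (∑ l, w l - ∑ l, w l * (σ l * ρ).trace.re ^ 2)) := by
        rw [← Finset.sum_sub_distrib, Finset.mul_sum, Finset.mul_sum]
        exact Finset.sum_congr rfl fun _ _ => by ring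
    _ ≤ _ := by
        rw [hw1]
        have : (0 : ℝ) ≤ n * (n - k) := mul_nonneg (Nat.cast_nonneg _) (sub_nonneg.2 h5)
        refine mul_le_mul_of_nonneg_left ?_ this
        linarith

end Measurements

/-! ### Traces of tensor products and linearity of the embedding -/

section Embed

lemma trace_tensor {V : Type*} [Fintype V] [DecidableEq V] {A : V → Type*}
    [∀ v, Fintype (A v)] (K : ∀ v, Matrix (A v) (A v) ℂ) :
    (tensor K).trace = ∏ v, (K v).trace := by
  simp [Matrix.trace, tensor, Fintype.prod_sum]

variable {V : Type*} [Fintype V] [DecidableEq V] {A : V → Type*} [∀ v, DecidableEq (A v)]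

lemma embed_sub (i : V) (P Q : Matrix (A i) (A i) ℂ) : embed i (P - Q) = embed i P - embed i Q := by
  have h : ∀ (R : Matrix (A i) (A i) ℂ) x y, embed i R x y =
      R (x i) (y i) * ∏ v ∈ Finset.univ.erase i, (1 : Matrix (A v) (A v) ℂ) (x v) (y v) := by
    intro R x y
    simp only [embed, tensor, Matrix.of_apply]
    rw [← Finset.mul_prod_erase _ _ (Finset.mem_univ i), Function.update_self]
    congr 1
    refine Finset.prod_congr rfl fun v hv => ?_
    rw [Function.update_of_ne (Finset.ne_of_mem_erase hv)]
  ext x y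
  rw [Matrix.sub_apply, h, h, h, Matrix.sub_apply, sub_mul]

end Embed

/-! ### Covariances of local observables on source states -/

section Network

variable {n : ℕ} {G : Network n} {m : {e // e ∈ G} → Fin n → ℕ}

/-- Regrouping of the distributed systems from nodes to sources. -/
def nodeEquiv (G : Network n) (m : {e // e ∈ G} → Fin n → ℕ) :
    (∀ v, NodeIdx G m v) ≃ (∀ e, SourceIdx G m e) where
  toFun x e v := x v.1 ⟨e, v.2⟩
  invFun y v e := y e.1 ⟨v, e.2⟩
  left_inv _ := rfl
  right_inv _ := rfl

lemma networkState_eq_submatrix (γ : ∀ e, Matrix (SourceIdx G m e) (SourceIdx G m e) ℂ) :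
    networkState G m γ = (tensor γ).submatrix (nodeEquiv G m) (nodeEquiv G m) := rfl

lemma networkState_mul (γ δ : ∀ e, Matrix (SourceIdx G m e) (SourceIdx G m e) ℂ) :
    networkState G m (fun e => γ e * δ e) = networkState G m γ * networkState G m δ := by
  simp only [networkState_eq_submatrix, tensor_mul, Matrix.submatrix_mul_equiv]

lemma networkState_conjTranspose (γ : ∀ e, Matrix (SourceIdx G m e) (SourceIdx G m e) ℂ) :
    (networkState G m γ)ᴴ = networkState G m fun e => (γ e)ᴴ := by
  simp only [networkState_eq_submatrix, Matrix.conjTranspose_submatrix, tensor_conjTranspose]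

lemma networkState_isState {γ : ∀ e, Matrix (SourceIdx G m e) (SourceIdx G m e) ℂ}
    (hγ : ∀ e, IsState (γ e)) : IsState (networkState G m γ) := by
  refine ⟨(tensor_posSemidef fun e => (hγ e).1).submatrix _, ?_⟩
  have : (networkState G m γ).trace = (tensor γ).trace :=
    Equiv.sum_comp (nodeEquiv G m) fun y => tensor γ y y
  rw [this, trace_tensor]
  exact Finset.prod_eq_one fun e _ => (hγ e).2

/-- The entries of an operator on the distributed systems, grouped by sources. -/
def vec (N : Matrix (∀ v, NodeIdx G m v) (∀ v, NodeIdx G m v) ℂ) :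
    (∀ e, SourceIdx G m e × SourceIdx G m e) → ℂ :=
  fun w => N ((nodeEquiv G m).symm fun e => (w e).1) ((nodeEquiv G m).symm fun e => (w e).2)

lemma vec_dotProduct (N N' : Matrix (∀ v, NodeIdx G m v) (∀ v, NodeIdx G m v) ℂ) :
    star (vec N) ⬝ᵥ vec N' = (Nᴴ * N').trace := by
  have h := Equiv.sum_comp ((Equiv.arrowProdEquivProdArrow _ (SourceIdx G m) (SourceIdx G m)).trans
    ((nodeEquiv G m).symm.prodCongr (nodeEquiv G m).symm))
    fun p => star (N p.1 p.2) * N' p.1 p.2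
  refine Eq.trans h ?_
  rw [Fintype.sum_prod_type, Finset.sum_comm]
  rfl

lemma vec_sum {ι : Type*} (s : Finset ι)
    (N : ι → Matrix (∀ v, NodeIdx G m v) (∀ v, NodeIdx G m v) ℂ) :
    ∑ i ∈ s, vec (N i) = vec (∑ i ∈ s, N i) := by
  ext w
  simp [vec, Matrix.sum_apply, Finset.sum_apply]

lemma nsq_vec (N : Matrix (∀ v, NodeIdx G m v) (∀ v, NodeIdx G m v) ℂ) :
    nsq (vec N) = (Nᴴ * N).trace.re := by
  rw [nsq_eq_dotProduct, vec_dotProduct]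

/-- An operator of a node that a source does not reach leaves the vector of that source alone. -/
lemma embed_mulVec_vec (L : ∀ e, Matrix (SourceIdx G m e) (SourceIdx G m e) ℂ)
    (hL : ∀ e, ((L e)ᴴ * L e).trace = 1) (e : {e // e ∈ G}) {i : Fin n} (hi : i ∉ e.1)
    (P : Matrix (NodeIdx G m i) (NodeIdx G m i) ℂ) :
    embed (A := fun e => SourceIdx G m e × SourceIdx G m e) e
      (Matrix.vecMulVec (fun p => L e p.1 p.2) (star fun p => L e p.1 p.2)) *ᵥ
        vec (embed i P * networkState G m L) = vec (embed i P * networkState G m L) := by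
  set x : (∀ e, SourceIdx G m e × SourceIdx G m e) → ∀ v, NodeIdx G m v :=
    fun w => (nodeEquiv G m).symm fun e => (w e).1 with hx
  set g : (∀ e, SourceIdx G m e × SourceIdx G m e) → ℂ := fun w =>
    ∑ ξ, P (x w i) ξ * ∏ e' ∈ Finset.univ.erase e,
      L e' (fun v => Function.update (x w) i ξ v.1 ⟨e', v.2⟩) (w e').2 with hg
  -- The operator at node `i` alters only row indices held by `i`. Source `e` has none, so its
  -- factor comes out of the sum unchanged.
  have hvec : vec (embed i P * networkState G m L) = fun w => L e (w e).1 (w e).2 * g w := by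
    ext w
    simp only [vec, Matrix.mul_apply]
    rw [sum_embed_mul i P _ fun y => networkState G m L y _, hg, Finset.mul_sum]
    refine Finset.sum_congr rfl fun ξ _ => ?_
    simp only [networkState, Matrix.of_apply]
    rw [← Finset.mul_prod_erase _ _ (Finset.mem_univ e), mul_left_comm]
    congr 2
    ext1 v
    have hv : v.1 ≠ i := fun h => hi (h ▸ v.2)
    rw [Function.update_of_ne hv]
    rfl
  have hgu : ∀ w u, g (Function.update w e u) = g w := by
    intro w u
    have hxe : ∀ (v : Fin n) (e' : {e' : {e // e ∈ G} // v ∈ e'.1}), e'.1 ≠ e →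
        x (Function.update w e u) v e' = x w v e' := by
      intro v e' he'
      simp only [hx, nodeEquiv, Equiv.coe_fn_symm_mk, Function.update_of_ne he']
    have hxi : x (Function.update w e u) i = x w i := by
      ext1 e'
      exact hxe i e' fun h => hi (h ▸ e'.2)
    simp only [hg, hxi]
    refine Finset.sum_congr rfl fun ξ _ => congrArg _ (Finset.prod_congr rfl fun e' he' => ?_)
    have hne := Finset.ne_of_mem_erase he'
    rw [Function.update_of_ne hne]
    congr 1
    ext1 ⟨v, hv⟩
    by_cases hvi : v = i
    · subst hvi
      simp only [Function.update_self]
    · simp only [Function.update_of_ne hvi]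
      exact hxe v ⟨e', hv⟩ hne
  rw [hvec]
  refine embed_mulVec_eq_self (W := fun e => SourceIdx G m e × SourceIdx G m e)
    (fun e p => L e p.1 p.2) e ?_ g hgu
  rw [← hL e]
  simp only [dotProduct, Pi.star_apply]
  rw [Fintype.sum_prod_type, Finset.sum_comm]
  rfl

lemma trace_mul_im_eq_zero {X : Type*} [Fintype X] {P Q : Matrix X X ℂ} (hP : P.IsHermitian)
    (hQ : Q.IsHermitian) : (P * Q).trace.im = 0 := by
  have h := Matrix.trace_conjTranspose (P * Q)
  rw [Matrix.conjTranspose_mul, hP.eq, hQ.eq, Matrix.trace_mul_comm] at h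
  have := congrArg Complex.im h
  rw [RCLike.star_def, Complex.conj_im] at this
  linarith

/-- The covariance matrix of local observables of the nodes of a `k`-network without shared
randomness. -/
lemma network_covariance {k : ℕ} (hG : G.IsKNetwork k)
    {γ : ∀ e, Matrix (SourceIdx G m e) (SourceIdx G m e) ℂ} (hγ : ∀ e, IsState (γ e))
    (A : ∀ v, Matrix (NodeIdx G m v) (NodeIdx G m v) ℂ) (hA : ∀ v, (A v).IsHermitian) :
    (∑ i, ∑ j, (embed i (A i) * embed j (A j) * networkState G m γ).trace.re)
        - k * ∑ i, (embed i (A i) * embed i (A i) * networkState G m γ).trace.re ≤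
      (∑ i, (embed i (A i) * networkState G m γ).trace.re) ^ 2
        - k * ∑ i, (embed i (A i) * networkState G m γ).trace.re ^ 2 := by
  choose B hB using fun e => exists_eq_conjTranspose_mul_self (hγ e).1
  -- With γ_e = L_e L_e†, the vector of L_e is a purification of γ_e, the column index playing the
  -- ancilla.
  set L : ∀ e, Matrix (SourceIdx G m e) (SourceIdx G m e) ℂ := fun e => (B e)ᴴ with hLdef
  set S := networkState G m L with hS
  set T := networkState G m γ with hT
  have hTS : T = S * Sᴴ := by
    rw [hT, hS, networkState_conjTranspose, ← networkState_mul]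
    congr 1
    ext1 e
    rw [hB e, hLdef, Matrix.conjTranspose_conjTranspose]
  have hL : ∀ e, ((L e)ᴴ * L e).trace = 1 := fun e => by
    rw [hLdef, Matrix.conjTranspose_conjTranspose, Matrix.trace_mul_comm, ← hB, (hγ e).2]
  have hstate : IsState T := networkState_isState hγ
  have hAH : ∀ i, (embed i (A i))ᴴ = embed i (A i) := fun i => by
    rw [embed_conjTranspose, (hA i).eq]
  have htr : ∀ N N' : Matrix (∀ v, NodeIdx G m v) (∀ v, NodeIdx G m v) ℂ,
      ((N * S)ᴴ * (N' * S)).trace = (Nᴴ * N' * T).trace := fun N N' => by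
    rw [Matrix.conjTranspose_mul, Matrix.mul_assoc, Matrix.trace_mul_comm, hTS]
    simp only [Matrix.mul_assoc]
  have key := excess_le_of_product (k := k) (W := fun e => SourceIdx G m e × SourceIdx G m e)
    (fun e p => L e p.1 p.2)
    (fun e => by
      rw [← hL e]
      simp only [dotProduct, Pi.star_apply]
      rw [Fintype.sum_prod_type, Finset.sum_comm]
      rfl)
    (fun e => e.1) (fun e => hG e.1 e.2) (fun i => vec (embed i (A i) * S))
    (fun e i hi => embed_mulVec_vec L hL e hi (A i))
  have hΨ : (fun w : ∀ e, SourceIdx G m e × SourceIdx G m e => ∏ e, L e (w e).1 (w e).2) =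
      vec S := rfl
  rw [hΨ] at key
  have hmean : ∀ i, star (vec S) ⬝ᵥ vec (embed i (A i) * S) =
      (((embed i (A i) * T).trace.re : ℝ) : ℂ) := fun i => by
    have h1 := htr 1 (embed i (A i))
    rw [Matrix.one_mul, Matrix.conjTranspose_one, Matrix.one_mul] at h1
    rw [vec_dotProduct, h1]
    refine Complex.ext (Complex.ofReal_re _).symm ?_
    rw [Complex.ofReal_im]
    exact trace_mul_im_eq_zero (hAH i) hstate.1.1
  have hS1 : nsq (vec S) = 1 := by
    rw [nsq_vec, Matrix.trace_mul_comm, ← hTS, hstate.2, Complex.one_re]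
  simp only [excess, hmean] at key
  rw [vec_sum, ← Finset.sum_mul, ← Finset.sum_smul, ← Complex.ofReal_sum, nsq_smul, hS1,
    nsq_vec, htr] at key
  simp only [nsq_smul, nsq_vec (embed _ _ * S), htr, hS1, mul_one, Complex.norm_real,
    Real.norm_eq_abs, sq_abs, hAH, Matrix.conjTranspose_sum] at key
  rw [Finset.sum_mul_sum] at key
  simp only [Finset.sum_mul, Matrix.trace_sum, Complex.re_sum] at key
  exact key

end Network

/-! ### Local channels in the Heisenberg picture -/

section Channels

variable {I J : Type*} [Fintype I] [DecidableEq I] [Fintype J]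

/-- The action of a channel on observables. -/
def Channel.dual (C : Channel I J) (P : Matrix J J ℂ) : Matrix I I ℂ :=
  ∑ a, (C.kraus a)ᴴ * P * C.kraus a

lemma Channel.dual_one [DecidableEq J] (C : Channel I J) : C.dual 1 = 1 := by
  simp only [Channel.dual, Matrix.mul_one, C.trace_preserving]

lemma Channel.dual_sub (C : Channel I J) (P Q : Matrix J J ℂ) :
    C.dual (P - Q) = C.dual P - C.dual Q := by
  simp only [Channel.dual, Matrix.mul_sub, Matrix.sub_mul, Finset.sum_sub_distrib]

lemma Channel.dual_posSemidef (C : Channel I J) {P : Matrix J J ℂ} (hP : P.PosSemidef) :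
    (C.dual P).PosSemidef :=
  Matrix.posSemidef_sum _ fun _ _ => hP.conjTranspose_mul_mul_same _

variable {V : Type*} [Fintype V] [DecidableEq V] {I J : V → Type*}
  [∀ v, Fintype (I v)] [∀ v, DecidableEq (I v)] [∀ v, Fintype (J v)]

/-- Moving the Kraus operators onto the effects reduces processed networks to observables on the
bare source state. -/
lemma trace_tensor_mul_applyLocal (C : ∀ v, Channel (I v) (J v))
    (E : ∀ v, Matrix (J v) (J v) ℂ) (τ : Matrix (∀ v, I v) (∀ v, I v) ℂ) :
    (tensor E * applyLocal C τ).trace = (tensor (fun v => (C v).dual (E v)) * τ).trace := by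
  simp only [Channel.dual, applyLocal]
  rw [tensor_sum, Finset.sum_mul, Finset.mul_sum, Matrix.trace_sum, Matrix.trace_sum]
  refine Finset.sum_congr rfl fun a _ => ?_
  rw [tensor_mul, tensor_mul, ← tensor_conjTranspose, ← Matrix.mul_assoc, Matrix.trace_mul_comm]
  simp only [Matrix.mul_assoc]

lemma applyLocal_isState [∀ v, DecidableEq (J v)] (C : ∀ v, Channel (I v) (J v))
    {τ : Matrix (∀ v, I v) (∀ v, I v) ℂ} (hτ : IsState τ) : IsState (applyLocal C τ) := by
  refine ⟨Matrix.posSemidef_sum _ fun a _ => hτ.1.mul_mul_conjTranspose_same _, ?_⟩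
  have h := trace_tensor_mul_applyLocal C (fun _ => 1) τ
  simpa only [Channel.dual_one, tensor_one, Matrix.one_mul, hτ.2] using h

end Channels

variable {n : ℕ} {d : Fin n → ℕ} (M : ∀ v, PMMeasurement (d v))

/-- The observable `E₁ - E₋₁` of a measurement. -/
def PMMeasurement.observable {δ : ℕ} (P : PMMeasurement δ) : Matrix (Fin δ) (Fin δ) ℂ :=
  P.effect 1 - P.effect (-1)

lemma sum_units_int {R : Type*} [AddCommMonoid R] (f : ℤˣ → R) : ∑ s, f s = f 1 + f (-1) := by
  have : (Finset.univ : Finset ℤˣ) = {1, -1} := rfl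
  rw [this, Finset.sum_pair (by decide)]

lemma PMMeasurement.effect_neg_one {δ : ℕ} (P : PMMeasurement δ) :
    P.effect (-1) = 1 - P.effect 1 := by
  rw [← P.sum_eq_one, sum_units_int, add_sub_cancel_left]

/-- Each party's function weights its own effects: the sign yields its observable, the constant 1
yields the identity. -/
lemma expect_prod (ρ : Op d) (h : Fin n → ℤˣ → ℝ) :
    expect M ρ (fun x => ∏ v, h v (x v)) =
      (tensor (fun v => ∑ s, (h v s : ℂ) • (M v).effect s) * ρ).trace.re := by
  rw [tensor_sum, Finset.sum_mul, Matrix.trace_sum, Complex.re_sum]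
  refine Finset.sum_congr rfl fun x _ => ?_
  rw [tensor_smul, Matrix.smul_mul, Matrix.trace_smul, ← Complex.ofReal_prod, smul_eq_mul,
    Complex.re_ofReal_mul, mul_comm]
  rfl

section LocalChannels

variable {I : Fin n → Type*} [∀ v, Fintype (I v)] [∀ v, DecidableEq (I v)]
  (C : ∀ v, Channel (I v) (Fin (d v))) (τ : Matrix (∀ v, I v) (∀ v, I v) ℂ)

/-- The expectation of the product of the outcomes in `s`. -/
lemma expect_applyLocal_prod (s : Finset (Fin n)) :
    expect M (applyLocal C τ) (fun x => ∏ v ∈ s, outcome v x) =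
      (tensor (fun v => if v ∈ s then (C v).dual (M v).observable else 1) * τ).trace.re := by
  have h1 : (fun x : Fin n → ℤˣ => ∏ v ∈ s, outcome v x) =
      fun x => ∏ v, (fun (v : Fin n) (t : ℤˣ) => if v ∈ s then ((t : ℤ) : ℝ) else 1) v (x v) := by
    ext x
    rw [Finset.prod_ite_mem, Finset.univ_inter]
    rfl
  rw [h1, expect_prod M _ fun v t => if v ∈ s then ((t : ℤ) : ℝ) else 1, trace_tensor_mul_applyLocal]
  congr 4
  ext1 v
  by_cases hv : v ∈ s
  · simp [hv, PMMeasurement.observable, sub_eq_add_neg]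
  · simp only [hv, if_false, Complex.ofReal_one, one_smul, (M v).sum_eq_one, Channel.dual_one]

lemma expect_applyLocal_outcome (i : Fin n) :
    expect M (applyLocal C τ) (outcome i) =
      (embed i ((C i).dual (M i).observable) * τ).trace.re := by
  have h := expect_applyLocal_prod M C τ {i}
  simp only [Finset.prod_singleton, Finset.mem_singleton] at h
  refine h.trans ?_
  congr 4
  ext1 v
  by_cases hv : v = i
  · subst hv; simp
  · simp [hv]

lemma expect_applyLocal_outcome_mul {i j : Fin n} (hij : i ≠ j) :
    expect M (applyLocal C τ) (fun x => outcome i x * outcome j x) =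
      (embed i ((C i).dual (M i).observable) * embed j ((C j).dual (M j).observable)
        * τ).trace.re := by
  have h := expect_applyLocal_prod M C τ {i, j}
  simp only [Finset.prod_pair hij, Finset.mem_insert, Finset.mem_singleton] at h
  refine h.trans ?_
  simp only [embed]
  rw [← tensor_mul]
  congr 4
  ext1 v
  by_cases hv : v = i
  · subst hv; simp [hij]
  · by_cases hv' : v = j
    · subst hv'; simp [hv]
    · simp [hv, hv']

/-- The observable is 2F - 1 with 0 ≤ F ≤ 1, and its square is 1 - 4(F - F²). Equality can fail,
since F need not be a projection. -/
lemma trace_embed_sq_le {τ : Matrix (∀ v, I v) (∀ v, I v) ℂ} (hτ : IsState τ) (i : Fin n) :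
    (embed i ((C i).dual (M i).observable) * embed i ((C i).dual (M i).observable)
      * τ).trace.re ≤ 1 := by
  set F := embed i ((C i).dual ((M i).effect 1)) with hF
  have hF0 : F.PosSemidef := embed_posSemidef i ((C i).dual_posSemidef ((M i).posSemidef 1))
  have hF1 : embed i ((C i).dual ((M i).effect (-1))) = 1 - F := by
    rw [(M i).effect_neg_one, Channel.dual_sub, embed_sub, Channel.dual_one, embed_one]
  have hF1' : (1 - F).PosSemidef :=
    hF1 ▸ embed_posSemidef i ((C i).dual_posSemidef ((M i).posSemidef (-1)))
  have hobs : embed i ((C i).dual (M i).observable) = F - (1 - F) := by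
    rw [PMMeasurement.observable, Channel.dual_sub, embed_sub, hF1]
  have hsq : (F - (1 - F)) * (F - (1 - F)) = 1 - (4 : ℝ) • (F - F * F) := by
    rw [← Nat.cast_ofNat (n := 4), Nat.cast_smul_eq_nsmul]
    noncomm_ring
  have h := trace_mul_re_nonneg (sub_sq_posSemidef hF0 hF1') hτ.1
  rw [hobs, hsq, Matrix.sub_mul, Matrix.one_mul, Matrix.trace_sub, hτ.2, Matrix.smul_mul,
    Matrix.trace_smul, Complex.sub_re, Complex.one_re, Complex.smul_re, smul_eq_mul]
  linarith

end LocalChannels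

/-- The covariance criterion for networks without shared randomness. -/
lemma omega_network_nonpos {k : ℕ} (hk : 1 ≤ k) {G : Network n} (hG : G.IsKNetwork k)
    {m : {e // e ∈ G} → Fin n → ℕ} {γ : ∀ e, Matrix (SourceIdx G m e) (SourceIdx G m e) ℂ}
    (hγ : ∀ e, IsState (γ e)) (C : ∀ v, Channel (NodeIdx G m v) (Fin (d v))) :
    omega k M (applyLocal C (networkState G m γ)) ≤ 0 := by
  set T := networkState G m γ with hT
  have hTs : IsState T := networkState_isState hγ
  set A : ∀ v, Matrix (NodeIdx G m v) (NodeIdx G m v) ℂ :=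
    fun v => (C v).dual (M v).observable with hA
  have hAH : ∀ v, (A v).IsHermitian := fun v => by
    rw [hA]
    simp only [PMMeasurement.observable, Channel.dual_sub]
    exact ((C v).dual_posSemidef ((M v).posSemidef 1)).1.sub
      ((C v).dual_posSemidef ((M v).posSemidef (-1))).1
  have key := network_covariance hG hγ A hAH
  set μ : Fin n → ℝ := fun i => (embed i (A i) * T).trace.re with hμ
  set r : Fin n → Fin n → ℝ := fun i j => (embed i (A i) * embed j (A j) * T).trace.re with hr
  change (∑ i, ∑ j, r i j) - k * ∑ i, r i i ≤ (∑ i, μ i) ^ 2 - k * ∑ i, μ i ^ 2 at key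
  -- On the diagonal the outcome squares to 1 whereas the squared observable only has mean `r i i ≤
  -- 1`; hence the correction.
  have hcov : ∀ i j, covMatrix M (applyLocal C T) i j =
      r i j - μ i * μ j + if i = j then 1 - r i i else 0 := by
    intro i j
    simp only [covMatrix, Matrix.of_apply, expect_applyLocal_outcome]
    by_cases hij : i = j
    · subst hij
      simp only [outcome_sq, expect_one M (applyLocal_isState C hTs), if_true]
      simp only [hμ, hA]
      ring
    · rw [expect_applyLocal_outcome_mul M C T hij, if_neg hij, add_zero]
  have hdiag : ∀ i, r i i ≤ 1 := fun i => trace_embed_sq_le M C hTs i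
  have h1 : ∑ i, ∑ j, covMatrix M (applyLocal C T) i j =
      ∑ i, ∑ j, r i j - (∑ i, μ i) ^ 2 + ∑ i, (1 - r i i) := by
    simp only [hcov, Finset.sum_add_distrib, Finset.sum_sub_distrib, Finset.sum_ite_eq,
      Finset.mem_univ, if_true, sq, Finset.sum_mul_sum]
  have h2 : (covMatrix M (applyLocal C T)).trace =
      ∑ i, r i i - ∑ i, μ i ^ 2 + ∑ i, (1 - r i i) := by
    simp only [Matrix.trace, Matrix.diag, hcov, if_true, Finset.sum_add_distrib,
      Finset.sum_sub_distrib, sq]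
  have h3 : 0 ≤ ∑ i, (1 - r i i) := Finset.sum_nonneg fun i _ => sub_nonneg.2 (hdiag i)
  -- The diagonal correction enters ω with coefficient 1 - k, which must not be positive.
  have h4 : (1 : ℝ) ≤ k := by exact_mod_cast hk
  rw [omega, h1, h2]
  nlinarith

/-! ### Mixtures, closure and decompositions of ρ -/

lemma IsState.mixture {X ι : Type*} [Fintype X] [Fintype ι] {w : ι → ℝ}
    {σ : ι → Matrix X X ℂ} (hw : ∀ l, 0 ≤ w l) (hw1 : ∑ l, w l = 1) (hσ : ∀ l, IsState (σ l)) :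
    IsState (∑ l, w l • σ l) := by
  refine ⟨Matrix.posSemidef_sum _ fun l _ => (hσ l).1.smul (hw l), ?_⟩
  simp only [Matrix.trace_sum, Matrix.trace_smul, (hσ _).2]
  rw [← Finset.sum_smul, hw1, one_smul]

lemma losrStates_isState {G : Network n} {σ : Op d} (hσ : σ ∈ losrStates G d) : IsState σ := by
  obtain ⟨m, γ, N, q, C, hγ, hq, hq1, rfl⟩ := hσ
  exact IsState.mixture hq hq1 fun l => applyLocal_isState _ (networkState_isState hγ)

lemma trace_of_mem_freeStates {G : Network n} {σ : Op d} (hσ : σ ∈ freeStates G d) :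
    σ.trace = 1 := by
  have hclosed : IsClosed {σ : Op d | σ.trace = 1} :=
    isClosed_eq continuous_id.matrix_trace continuous_const
  exact closure_minimal (fun σ hσ => (losrStates_isState hσ).2) hclosed hσ

/-- All sources send one-dimensional systems and every node prepares its basis state 0. -/
lemma freeStates_nonempty (G : Network n) (hd : ∀ v, 0 < d v) : (freeStates G d).Nonempty := by
  let m : {e // e ∈ G} → Fin n → ℕ := fun _ _ => 1
  let C : ∀ v, Channel (NodeIdx G m v) (Fin (d v)) := fun v =>
    { num := 1
      kraus := fun _ => Matrix.of fun j _ => if j = ⟨0, hd v⟩ then 1 else 0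
      trace_preserving := by
        ext x y
        have hxy : x = y := Subsingleton.elim _ _
        subst hxy
        simp [Matrix.mul_apply] }
  refine ⟨_, subset_closure ⟨m, fun _ => 1, 1, fun _ => 1, fun _ => C,
    fun e => ⟨Matrix.PosSemidef.one, ?_⟩, fun _ => zero_le_one, by simp, rfl⟩⟩
  simp [Matrix.trace_one, m]

@[fun_prop]
lemma continuous_expect (f : (Fin n → ℤˣ) → ℝ) : Continuous fun ρ : Op d => expect M ρ f := by
  refine continuous_finsetSum _ fun x _ => Continuous.mul ?_ continuous_const
  exact Complex.continuous_re.comp (continuous_const.matrix_mul continuous_id).matrix_trace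

lemma continuous_omega (k : ℕ) : Continuous fun ρ : Op d => omega k M ρ := by
  simp only [omega, covMatrix, Matrix.trace, Matrix.diag, Matrix.of_apply]
  fun_prop

/-- The value of `ω` on a mixture of a free state and an arbitrary state. -/
lemma omega_add_le {k : ℕ} (hk : 1 ≤ k) (hkn : k ≤ n) {G : Network n} (hG : G.IsKNetwork k)
    {σ τ : Op d} (hσ : σ ∈ freeStates G d) (hτ : IsState τ) {p : ℝ} (hp0 : 0 ≤ p) (hp1 : p ≤ 1) :
    omega k M ((1 - p) • σ + p • τ) ≤ n * (n - k) * p + n * (n - k) *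
      (4 * (1 - (((1 - p) • σ + p • τ) * ((1 - p) • σ + p • τ)).trace.re ^ 2)) := by
  have hcont : Continuous fun σ : Op d => (1 - p) • σ + p • τ := by fun_prop
  -- Both sides are continuous in σ for fixed τ and p, so σ may be taken to be a finite LOSR
  -- mixture.
  have hclosed : IsClosed {σ : Op d | omega k M ((1 - p) • σ + p • τ) ≤
      n * (n - k) * p + n * (n - k) *
      (4 * (1 - (((1 - p) • σ + p • τ) * ((1 - p) • σ + p • τ)).trace.re ^ 2))} := by
    refine isClosed_le ((continuous_omega M k).comp hcont) ?_
    have h : Continuous fun σ : Op d =>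
        (((1 - p) • σ + p • τ) * ((1 - p) • σ + p • τ)).trace.re :=
      Complex.continuous_re.comp (hcont.matrix_mul hcont).matrix_trace
    fun_prop
  refine closure_minimal (fun σ hσ => ?_) hclosed hσ
  obtain ⟨m, γ, N, q, C, hγ, hq, hq1, rfl⟩ := hσ
  -- `none` labels τ, so ρ becomes a single mixture of τ and network states without shared
  -- randomness.
  let w : Option (Fin N) → ℝ := fun o => o.elim p fun l => (1 - p) * q l
  let υ : Option (Fin N) → Op d := fun o => o.elim τ fun l => applyLocal (C l) (networkState G m γ)
  have hw : ∀ o, 0 ≤ w o := by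
    rintro (_ | l)
    · exact hp0
    · exact mul_nonneg (sub_nonneg.2 hp1) (hq l)
  have hw1 : ∑ o, w o = 1 := by
    rw [Fintype.sum_option]
    simp only [w, Option.elim, ← Finset.mul_sum, hq1]
    ring
  have hυ : ∀ o, IsState (υ o) := by
    rintro (_ | l)
    · exact hτ
    · exact applyLocal_isState _ (networkState_isState hγ)
  have hmix : (1 - p) • (∑ l, q l • applyLocal (C l) (networkState G m γ)) + p • τ =
      ∑ o, w o • υ o := by
    rw [Fintype.sum_option, add_comm, Finset.smul_sum]
    simp only [w, υ, Option.elim, smul_smul]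
  rw [Set.mem_ofPred_eq, hmix]
  refine (omega_mixture_le M hw hw1 hυ (IsState.mixture hw hw1 hυ) hkn).trans ?_
  refine add_le_add_left ?_ _
  rw [Fintype.sum_option]
  have h1 : w none * omega k M (υ none) ≤ n * (n - k) * p := by
    rw [mul_comm]
    exact mul_le_mul_of_nonneg_right (omega_le M hτ hkn) hp0
  have h2 : ∑ l, w (some l) * omega k M (υ (some l)) ≤ 0 :=
    Finset.sum_nonpos fun l _ =>
      mul_nonpos_of_nonneg_of_nonpos (hw _) (omega_network_nonpos M hk hG hγ (C l))
  linarith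

lemma nonneg_of_posSemidef_sub {G : Network n} {ρ σ : Op d} (hρ : IsState ρ)
    (hσ : σ ∈ freeStates G d) {p : ℝ} (h : (ρ - (1 - p) • σ).PosSemidef) : 0 ≤ p := by
  have := (Complex.nonneg_iff.1 h.trace_nonneg).1
  rw [Matrix.trace_sub, Matrix.trace_smul, hρ.2, trace_of_mem_freeStates hσ, Complex.sub_re,
    Complex.smul_re, Complex.one_re, smul_eq_mul] at this
  linarith

/-- The mixed part of a decomposition of `ρ` is a multiple of a state. -/
lemma exists_mixture {G : Network n} {ρ σ : Op d} (hρ : IsState ρ)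
    (hσ : σ ∈ freeStates G d) {p : ℝ} (h : (ρ - (1 - p) • σ).PosSemidef) :
    ∃ τ, IsState τ ∧ ρ = (1 - p) • σ + p • τ := by
  have htr : (ρ - (1 - p) • σ).trace = (p : ℂ) := by
    rw [Matrix.trace_sub, Matrix.trace_smul, hρ.2, trace_of_mem_freeStates hσ, Complex.real_smul]
    push_cast
    ring
  have hp0 := nonneg_of_posSemidef_sub hρ hσ h
  rcases hp0.eq_or_lt with hp | hp
  -- For p = 0 the remainder has trace zero and vanishes, so any state can serve as τ.
  · refine ⟨ρ, hρ, ?_⟩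
    subst hp
    rw [Complex.ofReal_zero, h.trace_eq_zero_iff, sub_eq_zero] at htr
    rw [zero_smul, add_zero]
    exact htr
  · refine ⟨p⁻¹ • (ρ - (1 - p) • σ), ⟨h.smul (inv_nonneg.2 hp0), ?_⟩, ?_⟩
    · rw [Matrix.trace_smul, htr, Complex.real_smul, ← Complex.ofReal_mul, inv_mul_cancel₀ hp.ne',
        Complex.ofReal_one]
    · rw [smul_smul, mul_inv_cancel₀ hp.ne', one_smul, add_sub_cancel]

end QNet

end

theorem mainTheorem8 {n k : ℕ} (hk : 1 ≤ k) (hkn : k < n) (G : QNet.Network n)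
    (hG : G.IsKNetwork k) (d : Fin n → ℕ) (ρ : QNet.Op d) (hρ : QNet.IsState ρ)
    (M : ∀ v, QNet.PMMeasurement (d v)) :
    QNet.weight G ρ ≥ QNet.omega k M ρ / ((n : ℝ) * ((n : ℝ) - (k : ℝ))) - QNet.beta ρ := by
  -- A zero-dimensional factor would force tr ρ = 0.
  have hd : ∀ v, 0 < d v := by
    intro v
    by_contra hv
    have : IsEmpty (∀ v, Fin (d v)) := ⟨fun x => hv ((Nat.zero_le _).trans_lt (x v).2)⟩
    have h := hρ.2
    rw [Matrix.trace, Fintype.sum_empty] at h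
    exact zero_ne_one h
  obtain ⟨σ₀, hσ₀⟩ := QNet.freeStates_nonempty G hd
  have hkn' : (k : ℝ) < n := Nat.cast_lt.2 hkn
  have hc : (0 : ℝ) < n * (n - k) :=
    mul_pos ((Nat.cast_nonneg k).trans_lt hkn') (sub_pos.2 hkn')
  -- The infimum runs over a nonempty set: p = 1 is admissible with any free state.
  refine le_csInf ⟨1, σ₀, hσ₀, by simpa using hρ.1⟩ ?_
  rintro p ⟨σ, hσ, hp⟩
  have hp0 := QNet.nonneg_of_posSemidef_sub hρ hσ hp
  have hβ0 : 0 ≤ QNet.beta ρ := mul_nonneg zero_le_two (Real.sqrt_nonneg _)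
  have hle1 : QNet.omega k M ρ / ((n : ℝ) * ((n : ℝ) - (k : ℝ))) ≤ 1 :=
    (div_le_one hc).2 (QNet.omega_le M hρ hkn.le)
  rcases le_or_gt 1 p with hp1 | hp1
  · linarith
  rcases le_or_gt 1 (QNet.beta ρ) with hβ1 | hβ1
  · linarith
  obtain ⟨τ, hτ, hmix⟩ := QNet.exists_mixture hρ hσ hp
  have hω := QNet.omega_add_le M hk hkn.le hG hσ hτ hp0 hp1.le
  rw [← hmix] at hω
  -- When 1 - (tr ρ²)² is positive the left side is β², and β < 1 here.
  have hβ : 4 * (1 - (ρ * ρ).trace.re ^ 2) ≤ QNet.beta ρ := by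
    rcases le_or_gt (1 - (ρ * ρ).trace.re ^ 2) 0 with h0 | h0
    · linarith
    · have hs := Real.sq_sqrt h0.le
      have hs0 := Real.sqrt_nonneg (1 - (ρ * ρ).trace.re ^ 2)
      rw [QNet.beta] at hβ1 ⊢
      nlinarith
  rw [sub_le_iff_le_add, div_le_iff₀ hc]
  nlinarith
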